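/- Let $K$ be a field, let $P=K[x_1,\dots,x_n]$ be ordered by the degree reverse lexicographic term order $\prec$ with $x_n\prec\cdots\prec x_1$, and let $I\subset P$ be a nonzero proper homogeneous ideal with $D=\dim(P/I)$ (Krull dimension). For $0\ne f\in P$ let $\mathrm{LT}(f)=x^\alpha$ be its leading term (with coefficient $1$), let $\mathrm{LT}(I)$ be the ideal generated by the leading terms of all nonzero elements of $I$, and let $X_P(f)=\{x_c,\dots,x_n\}$ with $c=\max\{i\mid\alpha_i\neq 0\}$ be the set of multiplicative variables of $f$ and of $x^\alpha$ (all variables if $\alpha=0$). A term $x^\beta$ is a Pommaret divisor of $x^\alpha$ if $x^\beta\mid x^\alpha$ and $x^{\alpha-\beta}\in K[X_P(x^\beta)]$. Let $H$ be a Pommaret basis of $I$, that is, a finite set of nonzero elements of $I$ such that no leading term of an element of $H$ is a Pommaret divisor of the leading term of another element of $H$, and $$\bigoplus_{h\in H}K[X_P(h)]\cdot \mathrm{LT}(h)=\mathrm{LT}(I).$$ The degree $\deg(I)$ is $(D-1)!$ times the leading coefficient of the Hilbert polynomial of $I$ if $D>0$, and the sum $\sum_{s\ge 0}\dim_K (P/I)_s$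 of the coefficients of the Hilbert series of $I$ if $D=0$; here the Hilbert polynomial is the polynomial that agrees with the Hilbert function $s\mapsto\dim_K(P/I)_s$ for all large $s$. Then $\deg(I)$ is well defined and $$\deg(I)=\sum_{\substack{h\in H\\ D\le |X_P(h)|\le D+\deg(h)}}(-1)^{|X_P(h)|-D+1}\binom{\deg(h)}{|X_P(h)|-D}.$$ -/

import Mathlib

open MvPolynomial Filter

-- the standard grading of the polynomial ring, used to speak of homogeneous ideals
attribute [local instance] MvPolynomial.gradedAlgebra

noncomputable section

namespace Pommaret

/-! ### The degree reverse lexicographic order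

The variables `x_1, …, x_n` are `X 0, …, X (n - 1)` with `x_n ≺ ⋯ ≺ x_1`. -/

/-- Exponent vectors, to be ordered by the degree reverse lexicographic order. -/
def DegRevLex (n : ℕ) : Type := Fin n →₀ ℕ

namespace DegRevLex

instance (n : ℕ) : AddCommMonoid (DegRevLex n) :=
  inferInstanceAs (AddCommMonoid (Fin n →₀ ℕ))

/-- The identity map from exponent vectors. -/
def of (n : ℕ) : (Fin n →₀ ℕ) ≃+ DegRevLex n := AddEquiv.refl _

/-- The sort key of an exponent vector: first the total degree, then the reversed exponent vector,
compared lexicographically with the order turned around. -/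
def key (n : ℕ) (a : DegRevLex n) : ℕ ×ₗ (Lex (Fin n → ℕ))ᵒᵈ :=
  toLex (((of n).symm a).degree,
    OrderDual.toDual (toLex fun i : Fin n => (of n).symm a i.rev))

theorem key_injective (n : ℕ) : Function.Injective (key n) := by
  intro a b h
  have h2 := congrArg (fun x => ofLex (OrderDual.ofDual (ofLex x).2)) h
  apply (of n).symm.injective
  ext i
  have := congrFun h2 i.rev
  simpa [key] using this

instance (n : ℕ) : LinearOrder (DegRevLex n) :=
  LinearOrder.lift' (key n) (key_injective n)

/-- `a ≺ b` iff `|a| < |b|`, or `|a| = |b|` and at the last position where they differ the exponent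
of `a` is larger. -/
theorem lt_iff {n : ℕ} {a b : Fin n →₀ ℕ} :
    of n a < of n b ↔ a.degree < b.degree ∨
      (a.degree = b.degree ∧ ∃ i, (∀ j, i < j → a j = b j) ∧ b i < a i) := by
  have h1 : of n a < of n b ↔ key n (of n a) < key n (of n b) := Iff.rfl
  rw [h1, key, key, Prod.Lex.toLex_lt_toLex]
  simp only [AddEquiv.symm_apply_apply, OrderDual.toDual_lt_toDual]
  refine or_congr Iff.rfl (and_congr Iff.rfl ⟨?_, ?_⟩)
  · rintro ⟨i, h, hi⟩
    refine ⟨i.rev, fun j hj => ?_, by simpa using hi⟩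
    have := h j.rev (show j.rev < i by rw [← Fin.rev_lt_rev]; simpa using hj)
    simpa using this.symm
  · rintro ⟨i, h, hi⟩
    refine ⟨i.rev, fun j hj => ?_, by simpa using hi⟩
    have := h j.rev (by rw [← Fin.rev_lt_rev]; simpa using hj)
    simpa using this.symm

theorem add_lt_add_left' {n : ℕ} (c : Fin n →₀ ℕ) {a b : Fin n →₀ ℕ} (h : of n a < of n b) :
    of n (c + a) < of n (c + b) := by
  rw [lt_iff] at h ⊢
  simpa using h

instance (n : ℕ) : IsOrderedAddMonoid (DegRevLex n) where
  add_le_add_left a b h c := by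
    rcases h.eq_or_lt with rfl | h
    · exact le_rfl
    · rw [add_comm a, add_comm b]
      exact (add_lt_add_left' ((of n).symm c) (a := (of n).symm a) (b := (of n).symm b) h).le

theorem of_monotone (n : ℕ) : Monotone (of n) := by
  intro a b h
  rcases h.eq_or_lt with rfl | h'
  · exact le_rfl
  · refine (lt_iff.2 (Or.inl ?_)).le
    obtain ⟨c, rfl⟩ := exists_add_of_le h
    have hc : c ≠ 0 := by rintro rfl; simp at h'
    have : c.degree ≠ 0 := by simpa [Finsupp.degree_eq_zero_iff] using hc
    rw [map_add]; omega

instance (n : ℕ) : WellFoundedLT (DegRevLex n) := by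
  have : WellQuasiOrderedLE (DegRevLex n) := by
    refine ⟨fun f => ?_⟩
    obtain ⟨i, j, hij, h⟩ := wellQuasiOrdered_le (α := Fin n →₀ ℕ) fun k => (of n).symm (f k)
    exact ⟨i, j, hij, by simpa using of_monotone n h⟩
  infer_instance

end DegRevLex

/-- The degree reverse lexicographic order with `x_n ≺ ⋯ ≺ x_1`. -/
def degRevLex (n : ℕ) : MonomialOrder (Fin n) where
  syn := DegRevLex n
  toSyn := DegRevLex.of n
  toSyn_monotone := DegRevLex.of_monotone n

variable {K : Type*} [Field K] {n : ℕ}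

/-- The exponent vector of the leading term of `f` (meaningful for `f ≠ 0`). -/
def ltExp (f : MvPolynomial (Fin n) K) : Fin n →₀ ℕ := (degRevLex n).degree f

/-- The leading term `x^α` of `f`, with coefficient one. -/
def lt (f : MvPolynomial (Fin n) K) : MvPolynomial (Fin n) K := monomial (ltExp f) 1

/-- The leading ideal, generated by the leading terms of all nonzero elements. -/
def leadingIdeal (I : Ideal (MvPolynomial (Fin n) K)) : Ideal (MvPolynomial (Fin n) K) :=
  Ideal.span {m | ∃ f ∈ I, f ≠ 0 ∧ m = lt f}

/-! ### Pommaret bases -/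

/-- The class of a term `x^α`: the largest index `i` with `α_i ≠ 0` (and `⊥` for the term `1`). -/
def cls (α : Fin n →₀ ℕ) : WithBot (Fin n) := α.support.max

/-- The multiplicative variables `x_{cls α}, …, x_n` of a term `x^α`
(all variables for the term `1`). -/
def multVars (α : Fin n →₀ ℕ) : Finset (Fin n) :=
  Finset.univ.filter fun i => cls α ≤ (i : WithBot (Fin n))

/-- `x^β` is a Pommaret divisor of `x^α`: `x^β ∣ x^α`, and the cofactor involves only
multiplicative variables of `x^β`. -/
def PommaretDvd (β α : Fin n →₀ ℕ) : Prop :=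
  β ≤ α ∧ (α - β).support ⊆ multVars β

/-- The multiplicative variables of a polynomial are those of its leading term. -/
def polyMultVars (h : MvPolynomial (Fin n) K) : Finset (Fin n) := multVars (ltExp h)

/-- The `K`-subspace `K[X_P(h)] · LT(h)`. -/
def cone (h : MvPolynomial (Fin n) K) : Submodule K (MvPolynomial (Fin n) K) :=
  (Subalgebra.toSubmodule (supported K (polyMultVars h : Set (Fin n)))).map
    (LinearMap.mulRight K (lt h))

/-- `H` is a Pommaret basis of `I`: a finite set of nonzero elements of `I`, no leading term of one
being a Pommaret divisor of the leading term of another, such that the leading ideal of `I` is the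
internal direct sum of the cones `K[X_P(h)] · LT(h)`, `h ∈ H`. -/
structure IsPommaretBasis (H : Finset (MvPolynomial (Fin n) K))
    (I : Ideal (MvPolynomial (Fin n) K)) : Prop where
  mem : ∀ h ∈ H, h ∈ I
  ne_zero : ∀ h ∈ H, h ≠ 0
  not_dvd : ∀ h ∈ H, ∀ h' ∈ H, h ≠ h' → ¬ PommaretDvd (ltExp h) (ltExp h')
  indep : iSupIndep fun h : H => cone (h : MvPolynomial (Fin n) K)
  sum_eq : ⨆ h : H, cone (h : MvPolynomial (Fin n) K) = (leadingIdeal I).restrictScalars K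

/-! ### Hilbert function and degree -/

/-- The degree `s` part of the factor ring `K[x_1, …, x_n] / I`. -/
def quotientPart (I : Ideal (MvPolynomial (Fin n) K)) (s : ℕ) :
    Submodule K (MvPolynomial (Fin n) K ⧸ I) :=
  (homogeneousSubmodule (Fin n) K s).map (Ideal.Quotient.mkₐ K I).toLinearMap

/-- The Hilbert function of `I`. -/
def hilbertFunction (I : Ideal (MvPolynomial (Fin n) K)) (s : ℕ) : ℕ :=
  Module.finrank K (quotientPart I s)

/-- `p` is the Hilbert polynomial of `I`: it agrees with the Hilbert function from a certain degree
on. -/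
def IsHilbertPolynomial (I : Ideal (MvPolynomial (Fin n) K)) (p : Polynomial ℚ) : Prop :=
  ∀ᶠ s : ℕ in atTop, (hilbertFunction I s : ℚ) = p.eval (s : ℚ)

theorem IsHilbertPolynomial.unique {I : Ideal (MvPolynomial (Fin n) K)} {p q : Polynomial ℚ}
    (hp : IsHilbertPolynomial I p) (hq : IsHilbertPolynomial I q) : p = q := by
  obtain ⟨N, hN⟩ := eventually_atTop.1 (hp.and hq)
  refine Polynomial.eq_of_infinite_eval_eq p q
    (((Set.Ici_infinite N).image (Nat.cast_injective (R := ℚ)).injOn).mono ?_)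
  rintro _ ⟨s, hs, rfl⟩
  exact (hN s hs).1.symm.trans (hN s hs).2

/-- `δ` is the degree of `I`. With `D` the Krull dimension of the factor ring, the degree is
`(D - 1)!` times the leading coefficient of the Hilbert polynomial when `D > 0`
(below `D = d + 1`), and the sum of the coefficients of the Hilbert series when `D = 0`. -/
def HasDegree (I : Ideal (MvPolynomial (Fin n) K)) (δ : ℚ) : Prop :=
  (∃ d : ℕ, ringKrullDim (MvPolynomial (Fin n) K ⧸ I) = ((d + 1 : ℕ) : WithBot ℕ∞) ∧
    ∃ p : Polynomial ℚ, IsHilbertPolynomial I p ∧ δ = (d.factorial : ℚ) * p.leadingCoeff) ∨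
  (ringKrullDim (MvPolynomial (Fin n) K ⧸ I) = 0 ∧
    (Function.support (hilbertFunction I)).Finite ∧
    δ = ((∑ᶠ s, hilbertFunction I s : ℕ) : ℚ))

theorem HasDegree.unique {I : Ideal (MvPolynomial (Fin n) K)} {δ ε : ℚ}
    (hδ : HasDegree I δ) (hε : HasDegree I ε) : δ = ε := by
  rcases hδ with ⟨d, hd, p, hp, rfl⟩ | ⟨h0, -, rfl⟩ <;>
    rcases hε with ⟨e, he, q, hq, rfl⟩ | ⟨h0', -, rfl⟩
  · have h := hd.symm.trans he
    obtain rfl : d = e := by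
      have : d + 1 = e + 1 := by exact_mod_cast h
      omega
    rw [hp.unique hq]
  · have h := hd.symm.trans h0'
    have : d + 1 = 0 := by exact_mod_cast h
    omega
  · have h := he.symm.trans h0
    have : e + 1 = 0 := by exact_mod_cast h
    omega
  · rfl

end Pommaret

end

namespace Pommaret

theorem ringKrullDim_eq_of_isIntegral {R S : Type*} [CommRing R] [CommRing S] [Algebra R S]
    [Algebra.IsIntegral R S] (hinj : Function.Injective (algebraMap R S)) :
    ringKrullDim R = ringKrullDim S := by
  refine le_antisymm ?_ ?_
  · refine iSup_le fun l => ?_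
    obtain ⟨Q, -, hQ, hcomap⟩ := Ideal.exists_ideal_over_prime_of_isIntegral (S := S)
      l.head.asIdeal ⊥ (by
        rw [← RingHom.ker_eq_comap_bot, (RingHom.injective_iff_ker_eq_bot _).1 hinj]
        exact bot_le)
    have : Q.LiesOver l.head.asIdeal := ⟨hcomap.symm⟩
    obtain ⟨L, hL, -⟩ := Ideal.exists_ltSeries_of_hasGoingUp l Q
    rw [← hL]
    exact Order.LTSeries.length_le_krullDim L
  · refine Order.krullDim_le_of_strictMono (PrimeSpectrum.comap (algebraMap R S)) ?_
    intro P Q hPQ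
    exact Ideal.IsIntegral.comap_lt_comap (I := P.asIdeal) (J := Q.asIdeal) hPQ

theorem choose_sub_add_eq_sum (d k S : ℕ) (h : d ≤ S) :
    ((S - d + k).choose k : ℚ) =
      ∑ m ∈ Finset.range (k + 1), (-1) ^ (k - m) * (d.choose (k - m) : ℚ) * (S + m).choose m := by
  induction d generalizing k with
  | zero =>
    rw [Finset.sum_eq_single k]
    · simp
    · intro m hm hmk
      have : k - m ≠ 0 := by have := Finset.mem_range.1 hm; omega
      obtain ⟨t, ht⟩ := Nat.exists_eq_succ_of_ne_zero this
      simp [ht]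
    · simp
  | succ d ih =>
    cases k with
    | zero => simp
    | succ k =>
      have h1 := ih (k + 1) (by omega)
      have h2 := ih k (by omega)
      have e : S - d + (k + 1) = (S - (d + 1) + (k + 1)) + 1 := by omega
      have e' : S - d + k = S - (d + 1) + (k + 1) := by omega
      rw [e, Nat.choose_succ_succ, Nat.cast_add] at h1
      rw [e'] at h2
      rw [eq_sub_of_add_eq' h1, h2, Finset.sum_range_succ, Finset.sum_range_succ _ (k + 1),
        add_sub_right_comm, ← Finset.sum_sub_distrib]
      congr 1
      · refine Finset.sum_congr rfl fun m hm => ?_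
        have hm := Finset.mem_range.1 hm
        have : k + 1 - m = (k - m) + 1 := by omega
        rw [this, Nat.choose_succ_succ]
        push_cast
        ring
      · simp

/-- The polynomial `∑_{i < m} c_i * binom(x + i, i)`. -/
noncomputable def binomialSum (c : ℕ → ℚ) (m : ℕ) : Polynomial ℚ :=
  ∑ i ∈ Finset.range m, Polynomial.C (c i) * Polynomial.preHilbertPoly ℚ i 0

theorem eval_binomialSum (c : ℕ → ℚ) (m S : ℕ) :
    (binomialSum c m).eval (S : ℚ) = ∑ i ∈ Finset.range m, c i * (S + i).choose i := by
  simp [binomialSum, Polynomial.eval_finsetSum,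
    Polynomial.preHilbertPoly_eq_choose_sub_add ℚ _ (Nat.zero_le S)]

theorem degree_preHilbertPoly_zero (i : ℕ) :
    (Polynomial.preHilbertPoly ℚ i 0).degree = i := by
  have : Polynomial.preHilbertPoly ℚ i 0 ≠ 0 := by
    intro h
    have := Polynomial.leadingCoeff_preHilbertPoly ℚ i 0
    rw [h] at this
    simp at this
    exact (Nat.factorial_ne_zero i) (by exact_mod_cast this.symm)
  rw [Polynomial.degree_eq_natDegree this, Polynomial.natDegree_preHilbertPoly]

theorem degree_binomialSum_lt (c : ℕ → ℚ) (m : ℕ) : (binomialSum c m).degree < m := by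
  rw [binomialSum, ← Polynomial.mem_degreeLT]
  refine Submodule.sum_mem _ fun i hi => ?_
  rw [Polynomial.mem_degreeLT]
  refine (Polynomial.degree_mul_le_of_le Polynomial.degree_C_le le_rfl).trans_lt ?_
  rw [degree_preHilbertPoly_zero, zero_add]
  exact_mod_cast Finset.mem_range.1 hi

theorem binomialSum_succ (c : ℕ → ℚ) (m : ℕ) : binomialSum c (m + 1) =
    binomialSum c m + Polynomial.C (c m) * Polynomial.preHilbertPoly ℚ m 0 :=
  Finset.sum_range_succ _ _

theorem degree_binomialSum_lt_degree {c : ℕ → ℚ} {m : ℕ} (hc : c m ≠ 0) :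
    (binomialSum c m).degree <
      (Polynomial.C (c m) * Polynomial.preHilbertPoly ℚ m 0).degree := by
  rw [Polynomial.degree_C_mul hc, degree_preHilbertPoly_zero]
  exact degree_binomialSum_lt c m

theorem degree_binomialSum_succ {c : ℕ → ℚ} {m : ℕ} (hc : c m ≠ 0) :
    (binomialSum c (m + 1)).degree = m := by
  rw [binomialSum_succ,
    Polynomial.degree_add_eq_right_of_degree_lt (degree_binomialSum_lt_degree hc),
    Polynomial.degree_C_mul hc, degree_preHilbertPoly_zero]

theorem leadingCoeff_binomialSum_succ {c : ℕ → ℚ} {m : ℕ} (hc : c m ≠ 0) :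
    (binomialSum c (m + 1)).leadingCoeff = c m * (m.factorial : ℚ)⁻¹ := by
  rw [binomialSum_succ,
    Polynomial.leadingCoeff_add_of_degree_lt (degree_binomialSum_lt_degree hc),
    Polynomial.leadingCoeff_mul, Polynomial.leadingCoeff_C, Polynomial.leadingCoeff_preHilbertPoly]

/-- A combination of the `binom(x + i, i)` that grows like `binom(x + D, D)` has leading index
`D`. -/
theorem coeff_of_growth {c : ℕ → ℚ} {n D : ℕ} {G : ℕ → ℕ} {M : ℚ}
    (hG : ∀ᶠ S in atTop, (G S : ℚ) = ∑ m ∈ Finset.range (n + 1), c m * (S + m).choose m)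
    (hlow : ∀ S, (S + D).choose D ≤ G S) (hup : ∀ S, (G S : ℚ) ≤ M * (S + D).choose D) :
    (∀ m ≤ n, D < m → c m = 0) ∧ c D ≠ 0 ∧ D ≤ n := by
  set q := binomialSum c (n + 1) with hq
  set N := Polynomial.preHilbertPoly ℚ D 0 with hN
  have hNe (S : ℕ) : N.eval (S : ℚ) = (S + D).choose D := by
    simp [hN, Polynomial.preHilbertPoly_eq_choose_sub_add ℚ _ (Nat.zero_le S)]
  have hpos (S : ℕ) : (0 : ℚ) < (S + D).choose D := by
    exact_mod_cast Nat.choose_pos (by omega)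
  have hqe : ∀ᶠ S : ℕ in atTop, q.eval (S : ℚ) = G S := by
    filter_upwards [hG] with S hS
    rw [hS, hq, eval_binomialSum]
  have hlow' (S : ℕ) : ((S + D).choose D : ℚ) ≤ G S := by exact_mod_cast hlow S
  have hM : 0 < M := by
    have := (hpos 0).trans_le ((hlow' 0).trans (hup 0))
    exact pos_of_mul_pos_left this (hpos 0).le
  have hdeg : q.degree = D := by
    rw [← degree_preHilbertPoly_zero D, ← hN]
    refine le_antisymm (not_lt.1 fun hlt => ?_) (not_lt.1 fun hlt => ?_)
    · have := (Polynomial.div_tendsto_atTop_zero_of_degree_lt _ _ hlt).comp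
        (tendsto_natCast_atTop_atTop (R := ℚ))
      obtain ⟨S, hS, hS'⟩ := ((this.eventually_lt_const (u := 1 / M) (by positivity)).and hqe).exists
      simp only [Function.comp_apply, hS', hNe] at hS
      have hGpos : (0 : ℚ) < G S := (hpos S).trans_le (hlow' S)
      rw [div_lt_div_iff₀ hGpos hM] at hS
      linarith [hup S]
    · have := (Polynomial.div_tendsto_atTop_zero_of_degree_lt _ _ hlt).comp
        (tendsto_natCast_atTop_atTop (R := ℚ))
      obtain ⟨S, hS, hS'⟩ := ((this.eventually_lt_const (u := 1) one_pos).and hqe).exists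
      simp only [Function.comp_apply, hS', hNe] at hS
      rw [div_lt_one (hpos S)] at hS
      exact absurd (hlow' S) (not_le.2 hS)
  have key : ∀ k, (binomialSum c (k + 1)).degree = D →
      (∀ m ≤ k, D < m → c m = 0) ∧ c D ≠ 0 ∧ D ≤ k := by
    intro k
    induction k with
    | zero =>
      intro h
      by_cases hc : c 0 = 0
      · simp [binomialSum, hc] at h
      · rw [degree_binomialSum_succ hc] at h
        obtain rfl : 0 = D := by exact_mod_cast h
        exact ⟨by omega, hc, le_rfl⟩
    | succ k ih =>
      intro h
      by_cases hc : c (k + 1) = 0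
      · have e : binomialSum c (k + 1 + 1) = binomialSum c (k + 1) := by
          rw [binomialSum, Finset.sum_range_succ, hc]
          simp [binomialSum]
        obtain ⟨h1, h2, h3⟩ := ih (e ▸ h)
        refine ⟨fun m hm hD => ?_, h2, by omega⟩
        rcases hm.eq_or_lt with rfl | hm
        · exact hc
        · exact h1 m (by omega) hD
      · rw [degree_binomialSum_succ hc] at h
        obtain rfl : k + 1 = D := by exact_mod_cast h
        exact ⟨by omega, hc, le_rfl⟩
  exact key n hdeg

section Macaulay

variable {K : Type*} [Field K] {n : ℕ} (I : Ideal (MvPolynomial (Fin n) K))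

/-- The exponent vectors of the leading terms of the nonzero elements of `I`. -/
def ltSet : Set (Fin n →₀ ℕ) := {α | ∃ f ∈ I, f ≠ 0 ∧ ltExp f = α}

variable {I}

theorem ltExp_mem_support {f : MvPolynomial (Fin n) K} (hf : f ≠ 0) : ltExp f ∈ f.support :=
  (degRevLex n).degree_mem_support hf

theorem add_mem_ltSet {α : Fin n →₀ ℕ} (γ : Fin n →₀ ℕ) (h : α ∈ ltSet I) :
    γ + α ∈ ltSet I := by
  obtain ⟨f, hf, hf0, rfl⟩ := h
  refine ⟨monomial γ 1 * f, I.mul_mem_left _ hf, ?_, ?_⟩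
  · exact mul_ne_zero (by simp) hf0
  · classical
    rw [ltExp, MonomialOrder.degree_mul (by simp) hf0, MonomialOrder.degree_monomial,
      if_neg one_ne_zero]
    rfl

theorem mem_ltSet_of_le {α β : Fin n →₀ ℕ} (h : α ∈ ltSet I) (hle : α ≤ β) : β ∈ ltSet I := by
  rw [← tsub_add_cancel_of_le hle]
  exact add_mem_ltSet _ h

theorem leadingIdeal_eq_span_image :
    leadingIdeal I = Ideal.span ((fun s => monomial s (1 : K)) '' ltSet I) := by
  rw [leadingIdeal]
  congr 1
  ext m
  constructor
  · rintro ⟨f, hf, hf0, rfl⟩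
    exact ⟨_, ⟨f, hf, hf0, rfl⟩, rfl⟩
  · rintro ⟨_, ⟨f, hf, hf0, rfl⟩, rfl⟩
    exact ⟨f, hf, hf0, rfl⟩

theorem mem_leadingIdeal_iff {p : MvPolynomial (Fin n) K} :
    p ∈ leadingIdeal I ↔ ∀ α ∈ p.support, α ∈ ltSet I := by
  rw [leadingIdeal_eq_span_image, mem_ideal_span_monomial_image]
  refine forall₂_congr fun α _ => ⟨fun ⟨β, hβ, hle⟩ => mem_ltSet_of_le hβ hle, fun h => ⟨α, h, le_rfl⟩⟩

theorem monomial_mem_leadingIdeal_iff {α : Fin n →₀ ℕ} :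
    monomial α (1 : K) ∈ leadingIdeal I ↔ α ∈ ltSet I := by
  classical
  rw [mem_leadingIdeal_iff, support_monomial, if_neg one_ne_zero]
  simp

theorem zero_notMem_ltSet (hI : I ≠ ⊤) : (0 : Fin n →₀ ℕ) ∉ ltSet I := by
  rintro ⟨f, hf, hf0, h⟩
  have hC := (degRevLex n).eq_C_of_degree_eq_zero h
  refine hI (I.eq_top_of_isUnit_mem hf ?_)
  rw [hC]
  refine (IsUnit.mk0 _ ?_).map C
  exact (degRevLex n).leadingCoeff_ne_zero_iff.2 hf0

theorem eq_zero_of_mem_of_forall_notMem_ltSet {f : MvPolynomial (Fin n) K} (hf : f ∈ I)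
    (h : ∀ α ∈ f.support, α ∉ ltSet I) : f = 0 := by
  by_contra hf0
  exact h _ (ltExp_mem_support hf0) ⟨f, hf, hf0, rfl⟩

theorem linearIndependent_mk_monomial (T : Set (Fin n →₀ ℕ)) (hT : ∀ α ∈ T, α ∉ ltSet I) :
    LinearIndependent K fun α : T => Ideal.Quotient.mkₐ K I (monomial (α : Fin n →₀ ℕ) 1) := by
  have h1 : LinearIndependent K fun α : T => monomial (α : Fin n →₀ ℕ) (1 : K) := by
    have := (basisMonomials (Fin n) K).linearIndependent.comp
      (fun α : T => (α : Fin n →₀ ℕ)) Subtype.val_injective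
    simpa [Function.comp_def] using this
  refine h1.map (f := (Ideal.Quotient.mkₐ K I).toLinearMap) ?_
  rw [Submodule.disjoint_def]
  intro f hf hfI
  have hfs : f ∈ restrictSupport K T := by
    rw [restrictSupport_eq_span]
    refine Submodule.span_mono ?_ hf
    rintro _ ⟨α, rfl⟩
    exact ⟨α, α.2, rfl⟩
  refine eq_zero_of_mem_of_forall_notMem_ltSet (I := I) ?_ fun α hα => hT α (hfs hα)
  simpa [Ideal.Quotient.eq_zero_iff_mem] using hfI

theorem mk_monomial_mem_span (hI : I.IsHomogeneous (homogeneousSubmodule (Fin n) K))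
    (α : Fin n →₀ ℕ) :
    Ideal.Quotient.mkₐ K I (monomial α 1) ∈ Submodule.span K
      ((fun β => Ideal.Quotient.mkₐ K I (monomial β 1)) '' {β | β ∉ ltSet I ∧
        β.degree = α.degree}) := by
  induction h : (degRevLex n).toSyn α using WellFoundedLT.induction generalizing α with
  | ind a ih =>
  subst h
  by_cases hα : α ∈ ltSet I
  · obtain ⟨f, hf, hf0, hfα⟩ := hα
    set g := homogeneousComponent α.degree f with hg
    have hgI : g ∈ I := homogeneousComponent_mem_of_mem hI hf _
    have hc : coeff α g ≠ 0 := by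
      rw [hg, coeff_homogeneousComponent, if_pos rfl, ← hfα]
      exact mem_support_iff.1 (ltExp_mem_support hf0)
    have hgα : α ∈ g.support := mem_support_iff.2 hc
    have hsum : ∑ β ∈ g.support, coeff β g • Ideal.Quotient.mkₐ K I (monomial β 1) = 0 := by
      have h0 : Ideal.Quotient.mkₐ K I g = 0 := by simpa [Ideal.Quotient.eq_zero_iff_mem] using hgI
      rw [g.as_sum, map_sum] at h0
      rw [← h0]
      refine Finset.sum_congr rfl fun β _ => ?_
      rw [← map_smul, smul_monomial, smul_eq_mul, mul_one]
    rw [← Finset.add_sum_erase _ _ hgα] at hsum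
    have : Ideal.Quotient.mkₐ K I (monomial α 1) = -(coeff α g)⁻¹ •
        ∑ β ∈ g.support.erase α, coeff β g • Ideal.Quotient.mkₐ K I (monomial β 1) := by
      rw [eq_neg_of_add_eq_zero_right hsum, smul_neg, neg_smul, neg_neg, smul_smul,
        inv_mul_cancel₀ hc, one_smul]
    rw [this]
    refine Submodule.smul_mem _ _ (Submodule.sum_mem _ fun β hβ => Submodule.smul_mem _ _ ?_)
    obtain ⟨hne, hβ⟩ := Finset.mem_erase.1 hβ
    have hβ' := mem_support_iff.1 hβ
    rw [hg, coeff_homogeneousComponent] at hβ'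
    obtain ⟨hdeg, hβf⟩ : β.degree = α.degree ∧ coeff β f ≠ 0 := by
      by_cases hd : β.degree = α.degree
      · exact ⟨hd, by simpa [hd] using hβ'⟩
      · simp [hd] at hβ'
    have hlt : (degRevLex n).toSyn β < (degRevLex n).toSyn α := by
      refine lt_of_le_of_ne ?_ fun e => hne ((degRevLex n).toSyn.injective e)
      rw [← hfα]
      exact (degRevLex n).le_degree (mem_support_iff.2 hβf)
    have := ih _ hlt β rfl
    rwa [hdeg] at this
  · exact Submodule.subset_span ⟨α, ⟨hα, rfl⟩, rfl⟩

theorem quotientPart_eq_span (hI : I.IsHomogeneous (homogeneousSubmodule (Fin n) K)) (s : ℕ) :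
    quotientPart I s = Submodule.span K
      ((fun β => Ideal.Quotient.mkₐ K I (monomial β 1)) '' {β | β ∉ ltSet I ∧
        β.degree = s}) := by
  have e : homogeneousSubmodule (Fin n) K s = restrictSupport K {α | α.degree = s} :=
    homogeneousSubmodule_eq_finsupp_supported ..
  rw [quotientPart, e, restrictSupport_eq_span, Submodule.map_span, ← Set.image_comp]
  refine le_antisymm (Submodule.span_le.2 ?_) (Submodule.span_mono ?_)
  · rintro _ ⟨α, rfl, rfl⟩
    exact mk_monomial_mem_span hI α
  · rintro _ ⟨α, ⟨-, h⟩, rfl⟩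
    exact ⟨α, h, rfl⟩

theorem finite_degree_le (S : ℕ) : {α : Fin n →₀ ℕ | α.degree ≤ S}.Finite := by
  refine (Set.finite_Iic (Finsupp.equivFunOnFinite.symm fun _ => S : Fin n →₀ ℕ)).subset ?_
  intro α hα i
  exact (Finsupp.le_degree i α).trans hα

/-- Macaulay's theorem: the Hilbert function counts the monomials outside the leading ideal. -/
theorem hilbertFunction_eq_ncard (hI : I.IsHomogeneous (homogeneousSubmodule (Fin n) K)) (s : ℕ) :
    hilbertFunction I s = {α : Fin n →₀ ℕ | α ∉ ltSet I ∧ α.degree = s}.ncard := by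
  have hfin : {α : Fin n →₀ ℕ | α ∉ ltSet I ∧ α.degree = s}.Finite :=
    (finite_degree_le s).subset fun α h => h.2.le
  have := hfin.fintype
  rw [hilbertFunction, quotientPart_eq_span hI, Set.image_eq_range, finrank_span_eq_card
    (linearIndependent_mk_monomial _ fun α h => h.1), Set.fintypeCard_eq_ncard]

/-- The number of monomials of degree at most `S` outside the leading ideal. -/
noncomputable def stdCount (I : Ideal (MvPolynomial (Fin n) K)) (S : ℕ) : ℕ :=
  {α : Fin n →₀ ℕ | α ∉ ltSet I ∧ α.degree ≤ S}.ncard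

theorem stdCount_eq_sum (hI : I.IsHomogeneous (homogeneousSubmodule (Fin n) K)) (S : ℕ) :
    stdCount I S = ∑ s ∈ Finset.range (S + 1), hilbertFunction I s := by
  induction S with
  | zero => simp [stdCount, hilbertFunction_eq_ncard hI]
  | succ S ih =>
    rw [Finset.sum_range_succ, ← ih, hilbertFunction_eq_ncard hI, stdCount, stdCount,
      ← Set.ncard_union_eq ?_ ((finite_degree_le S).subset fun α h => h.2)
        ((finite_degree_le (S + 1)).subset fun α h => h.2.le)]
    · congr 1
      ext α
      simp only [Set.mem_union, Set.mem_ofPred_eq, ← and_or_left]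
      exact and_congr_right fun _ => by omega
    · rw [Set.disjoint_left]
      rintro α ⟨-, h⟩ ⟨-, h'⟩
      omega

end Macaulay
theorem sum_range_multichoose (k S : ℕ) :
    ∑ s ∈ Finset.range (S + 1), k.multichoose s = (S + k).choose k := by
  have : ∑ s ∈ Finset.range (S + 1), k.multichoose s = (k + 1).multichoose S := by
    induction S with
    | zero => simp
    | succ S ih => rw [Finset.sum_range_succ, ih, Nat.multichoose_succ_succ, add_comm]
  rw [this, Nat.multichoose_eq, ← Nat.choose_symm_add]
  congr 1
  omega

section Counting

variable {n : ℕ}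

theorem ncard_support_subset_degree_le (V : Finset (Fin n)) (S : ℕ) :
    {γ : Fin n →₀ ℕ | γ.support ⊆ V ∧ γ.degree ≤ S}.ncard = (S + V.card).choose V.card := by
  have hdeg {γ : Fin n →₀ ℕ} (h : γ.support ⊆ V) : V.sum γ = γ.degree :=
    (Finset.sum_subset h fun i _ hi => by simpa using hi).symm
  have : {γ : Fin n →₀ ℕ | γ.support ⊆ V ∧ γ.degree ≤ S} =
      ((Finset.range (S + 1)).biUnion fun s => V.finsuppAntidiag s : Finset (Fin n →₀ ℕ)) := by
    ext γ
    simp only [Set.mem_ofPred_eq, Finset.coe_biUnion, Set.mem_iUnion, Finset.mem_coe,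
      Finset.mem_range, Finset.mem_finsuppAntidiag, exists_prop]
    constructor
    · rintro ⟨h, hS⟩
      exact ⟨γ.degree, by omega, hdeg h, h⟩
    · rintro ⟨s, hs, h1, h2⟩
      rw [hdeg h2] at h1
      exact ⟨h2, by omega⟩
  rw [this, Set.ncard_coe_finset, Finset.card_biUnion]
  · simp_rw [Finset.card_finsuppAntidiag_nat_eq_multichoose]
    exact sum_range_multichoose _ _
  · intro s _ t _ hst
    rw [Function.onFun, Finset.disjoint_left]
    intro γ h1 h2
    rw [Finset.mem_finsuppAntidiag] at h1 h2
    exact hst (h1.1.symm.trans h2.1)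

theorem ncard_pommaretDvd_degree_le (β : Fin n →₀ ℕ) {S : ℕ} (hS : β.degree ≤ S) :
    {α : Fin n →₀ ℕ | PommaretDvd β α ∧ α.degree ≤ S}.ncard =
      (S - β.degree + (multVars β).card).choose (multVars β).card := by
  rw [← ncard_support_subset_degree_le,
    ← Set.ncard_image_of_injective {γ : Fin n →₀ ℕ |
      γ.support ⊆ multVars β ∧ γ.degree ≤ S - β.degree} (add_left_injective β)]
  congr 1
  ext α
  simp only [Set.mem_ofPred_eq, Set.mem_image]
  constructor
  · rintro ⟨⟨h1, h2⟩, h3⟩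
    refine ⟨α - β, ⟨h2, ?_⟩, tsub_add_cancel_of_le h1⟩
    rw [← tsub_add_cancel_of_le h1, map_add] at h3
    omega
  · rintro ⟨γ, ⟨h1, h2⟩, rfl⟩
    refine ⟨⟨le_add_self, by rwa [add_tsub_cancel_right]⟩, ?_⟩
    rw [map_add]
    omega

end Counting

section Basis

variable {K : Type*} [Field K] {n : ℕ}

theorem degree_le_of_toSyn_le {α β : Fin n →₀ ℕ}
    (h : (degRevLex n).toSyn α ≤ (degRevLex n).toSyn β) : α.degree ≤ β.degree := by
  rcases h.eq_or_lt with h | h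
  · rw [(degRevLex n).toSyn.injective h]
  · rcases DegRevLex.lt_iff.1 h with h | ⟨h, -⟩
    · exact h.le
    · exact h.le

theorem degree_ltExp (h : MvPolynomial (Fin n) K) : (ltExp h).degree = h.totalDegree := by
  by_cases h0 : h = 0
  · simp [h0, ltExp]
  refine le_antisymm ?_ ?_
  · exact le_totalDegree (ltExp_mem_support h0)
  · refine Finset.sup_le fun α hα => ?_
    exact degree_le_of_toSyn_le ((degRevLex n).le_degree hα)

theorem cone_eq_restrictSupport (h : MvPolynomial (Fin n) K) :
    cone h = restrictSupport K {α | PommaretDvd (ltExp h) α} := by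
  refine le_antisymm ?_ ?_
  · rintro _ ⟨p, hp, rfl⟩
    have hp : p ∈ supported K (polyMultVars h : Set (Fin n)) := hp
    rw [mem_supported] at hp
    simp only [LinearMap.mulRight_apply]
    rw [mem_restrictSupport_iff, lt]
    intro α hα
    rw [Finset.mem_coe, mem_support_iff, coeff_mul_monomial'] at hα
    split_ifs at hα with hle
    · refine ⟨hle, fun i hi => ?_⟩
      have : α - ltExp h ∈ p.support := by
        rw [mem_support_iff]
        simpa using hα
      exact_mod_cast hp ((mem_vars_iff_mem_support i).2 ⟨_, this, hi⟩)
    · exact absurd rfl hα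
  · rw [restrictSupport_eq_span, Submodule.span_le]
    rintro _ ⟨α, ⟨h1, h2⟩, rfl⟩
    refine ⟨monomial (α - ltExp h) 1, ?_, ?_⟩
    · change _ ∈ supported K (polyMultVars h : Set (Fin n))
      rw [mem_supported, vars_monomial one_ne_zero]
      exact_mod_cast h2
    · simp [lt, monomial_mul, tsub_add_cancel_of_le h1]

variable {I : Ideal (MvPolynomial (Fin n) K)} {H : Finset (MvPolynomial (Fin n) K)}

theorem IsPommaretBasis.ltExp_mem_ltSet (hH : IsPommaretBasis H I) {h} (hh : h ∈ H) :
    ltExp h ∈ ltSet I :=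
  ⟨h, hH.mem h hh, hH.ne_zero h hh, rfl⟩

theorem IsPommaretBasis.mem_ltSet_iff (hH : IsPommaretBasis H I) {α : Fin n →₀ ℕ} :
    α ∈ ltSet I ↔ ∃ h ∈ H, PommaretDvd (ltExp h) α := by
  constructor
  · intro hα
    have h1 : monomial α (1 : K) ∈ (leadingIdeal I).restrictScalars K :=
      monomial_mem_leadingIdeal_iff.2 hα
    rw [← hH.sum_eq] at h1
    have h2 : ⨆ h : H, cone (h : MvPolynomial (Fin n) K) ≤
        restrictSupport K {α | ∃ h ∈ H, PommaretDvd (ltExp h) α} := by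
      refine iSup_le fun h => ?_
      rw [cone_eq_restrictSupport]
      exact restrictSupport_mono _ fun β hβ => ⟨h, h.2, hβ⟩
    simpa using h2 h1
  · rintro ⟨h, hh, hdvd⟩
    exact mem_ltSet_of_le (hH.ltExp_mem_ltSet hh) hdvd.1

theorem IsPommaretBasis.eq_of_pommaretDvd (hH : IsPommaretBasis H I) {α : Fin n →₀ ℕ}
    {h h'} (hh : h ∈ H) (hh' : h' ∈ H) (hα : PommaretDvd (ltExp h) α)
    (hα' : PommaretDvd (ltExp h') α) : h = h' := by
  by_contra hne
  have hd := hH.indep.pairwiseDisjoint (show (⟨h, hh⟩ : H) ≠ ⟨h', hh'⟩ by simpa using hne)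
  simp only [Function.onFun, cone_eq_restrictSupport] at hd
  have := (Submodule.disjoint_def.1 hd) (monomial α 1) (by simpa using hα)
    (by simpa using hα')
  simp at this

theorem IsPommaretBasis.stdCount_add_sum (hH : IsPommaretBasis H I) {S : ℕ}
    (hS : ∀ h ∈ H, h.totalDegree ≤ S) :
    stdCount I S + ∑ h ∈ H, (S - h.totalDegree + (polyMultVars h).card).choose
      (polyMultVars h).card = (S + n).choose n := by
  classical
  set B := (finite_degree_le (n := n) S).toFinset with hB
  have hBm (α : Fin n →₀ ℕ) : α ∈ B ↔ α.degree ≤ S := by simp [hB]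
  have h1 : stdCount I S = (B.filter (· ∉ ltSet I)).card := by
    rw [stdCount, ← Set.ncard_coe_finset]
    congr 1
    ext α
    simp [hBm, and_comm]
  have h2 : ∀ h ∈ H, (S - h.totalDegree + (polyMultVars h).card).choose (polyMultVars h).card =
      (B.filter (PommaretDvd (ltExp h) ·)).card := by
    intro h hh
    rw [← degree_ltExp, polyMultVars, ← ncard_pommaretDvd_degree_le _
      (by rw [degree_ltExp]; exact hS h hh), ← Set.ncard_coe_finset]
    congr 1
    ext α
    simp [hBm, and_comm]
  have h3 : (B.filter (· ∈ ltSet I)).card =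
      ∑ h ∈ H, (B.filter (PommaretDvd (ltExp h) ·)).card := by
    rw [← Finset.card_biUnion]
    · congr 1
      ext α
      simp only [Finset.mem_filter, Finset.mem_biUnion, hH.mem_ltSet_iff]
      tauto
    · intro h hh h' hh' hne
      rw [Function.onFun, Finset.disjoint_left]
      intro α ha ha'
      exact hne (hH.eq_of_pommaretDvd hh hh' (Finset.mem_filter.1 ha).2 (Finset.mem_filter.1 ha').2)
  have h4 : B.card = (S + n).choose n := by
    have := ncard_support_subset_degree_le (Finset.univ : Finset (Fin n)) S
    rw [Finset.card_univ, Fintype.card_fin] at this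
    rw [← this, ← Set.ncard_coe_finset]
    congr 1
    ext α
    simp [hBm]
  rw [h1, Finset.sum_congr rfl h2, ← h3, ← h4, add_comm]
  exact Finset.card_filter_add_card_filter_not _

/-- The coefficients of the cumulative Hilbert function with respect to the `binom(S + m, m)`. -/
noncomputable def degreeCoeff (H : Finset (MvPolynomial (Fin n) K)) (m : ℕ) : ℚ :=
  (if m = n then 1 else 0) - ∑ h ∈ H with m ≤ (polyMultVars h).card,
    (-1) ^ ((polyMultVars h).card - m) * (h.totalDegree.choose ((polyMultVars h).card - m) : ℚ)

theorem card_polyMultVars_le (h : MvPolynomial (Fin n) K) : (polyMultVars h).card ≤ n := by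
  simpa using Finset.card_le_univ (polyMultVars h)

theorem IsPommaretBasis.stdCount_eq (hH : IsPommaretBasis H I) {S : ℕ}
    (hS : ∀ h ∈ H, h.totalDegree ≤ S) :
    (stdCount I S : ℚ) = ∑ m ∈ Finset.range (n + 1), degreeCoeff H m * (S + m).choose m := by
  have h1 : (stdCount I S : ℚ) = (S + n).choose n - ∑ h ∈ H,
      ((S - h.totalDegree + (polyMultVars h).card).choose (polyMultVars h).card : ℚ) := by
    rw [← hH.stdCount_add_sum hS]
    push_cast
    ring
  simp_rw [h1, degreeCoeff, sub_mul, Finset.sum_sub_distrib, ite_mul, one_mul, zero_mul,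
    Finset.sum_ite_eq', Finset.mem_range, lt_add_one, if_true, Finset.sum_filter, Finset.sum_mul]
  rw [Finset.sum_comm]
  congr 1
  refine Finset.sum_congr rfl fun h hh => ?_
  rw [choose_sub_add_eq_sum _ _ _ (hS h hh)]
  simp_rw [ite_mul, zero_mul]
  rw [← Finset.sum_filter]
  refine Finset.sum_congr ?_ fun _ _ => rfl
  ext m
  have := card_polyMultVars_le h
  simp only [Finset.mem_range, Finset.mem_filter]
  omega

end Basis

section Dimension

variable {K : Type*} [Field K] {n : ℕ} {I : Ideal (MvPolynomial (Fin n) K)}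

/-- The monomials outside the leading ideal contain all monomials in the variables `V`, and are
products of such monomials with finitely many others. -/
structure IsStdNormalization (I : Ideal (MvPolynomial (Fin n) K)) (V : Finset (Fin n))
    (E : Finset (Fin n →₀ ℕ)) : Prop where
  not_subset : ∀ α ∈ ltSet I, ¬ α.support ⊆ V
  exists_add : ∀ α ∉ ltSet I, ∃ e ∈ E, ∃ γ : Fin n →₀ ℕ, γ.support ⊆ V ∧ γ + e = α

namespace IsStdNormalization

variable {V : Finset (Fin n)} {E : Finset (Fin n →₀ ℕ)}

theorem choose_le_stdCount (hV : IsStdNormalization I V E) (S : ℕ) :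
    (S + V.card).choose V.card ≤ stdCount I S := by
  rw [← ncard_support_subset_degree_le]
  exact Set.ncard_le_ncard (fun α h => ⟨fun hα => hV.not_subset α hα h.1, h.2⟩)
    ((finite_degree_le S).subset fun α h => h.2)

theorem stdCount_le (hV : IsStdNormalization I V E) (S : ℕ) :
    stdCount I S ≤ E.card * (S + V.card).choose V.card := by
  rw [← ncard_support_subset_degree_le, ← Set.ncard_coe_finset, ← Set.ncard_prod]
  have hfin : ((E : Set (Fin n →₀ ℕ)) ×ˢ
      {γ : Fin n →₀ ℕ | γ.support ⊆ V ∧ γ.degree ≤ S}).Finite :=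
    E.finite_toSet.prod ((finite_degree_le S).subset fun α h => h.2)
  refine (Set.ncard_le_ncard ?_ (hfin.image fun x => x.2 + x.1)).trans (Set.ncard_image_le hfin)
  rintro α ⟨hα, hS⟩
  obtain ⟨e, he, γ, hγ, rfl⟩ := hV.exists_add α hα
  rw [map_add] at hS
  exact ⟨(e, γ), ⟨he, hγ, le_self_add.trans hS⟩, rfl⟩

theorem ringKrullDim_eq (hV : IsStdNormalization I V E)
    (hI : I.IsHomogeneous (homogeneousSubmodule (Fin n) K)) :
    ringKrullDim (MvPolynomial (Fin n) K ⧸ I) = (V.card : WithBot ℕ∞) := by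
  classical
  let f : MvPolynomial V K →ₐ[K] MvPolynomial (Fin n) K ⧸ I :=
    (Ideal.Quotient.mkₐ K I).comp (rename (Subtype.val : V → Fin n))
  let : Algebra (MvPolynomial V K) (MvPolynomial (Fin n) K ⧸ I) := f.toRingHom.toAlgebra
  let : Module (MvPolynomial V K) (MvPolynomial (Fin n) K ⧸ I) := Algebra.toModule
  have hinj : Function.Injective (algebraMap (MvPolynomial V K) (MvPolynomial (Fin n) K ⧸ I)) := by
    refine (injective_iff_map_eq_zero _).2 fun p hp => ?_
    have hpI : rename (Subtype.val : V → Fin n) p ∈ I := Ideal.Quotient.eq_zero_iff_mem.1 hp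
    have hs : rename (Subtype.val : V → Fin n) p ∈ supported K (V : Set (Fin n)) := by
      rw [supported_eq_range_rename]
      exact ⟨p, rfl⟩
    rw [mem_supported] at hs
    refine rename_injective _ Subtype.val_injective ?_
    rw [map_zero]
    refine eq_zero_of_mem_of_forall_notMem_ltSet hpI fun α hα hαI => hV.not_subset α hαI ?_
    intro i hi
    exact_mod_cast hs ((mem_vars_iff_mem_support i).2 ⟨α, hα, hi⟩)
  have hmonomial (γ : Fin n →₀ ℕ) (hγ : γ.support ⊆ V) :
      ∃ p : MvPolynomial V K, rename (Subtype.val : V → Fin n) p = monomial γ 1 := by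
    have : monomial γ (1 : K) ∈ supported K (V : Set (Fin n)) := by
      rw [mem_supported, vars_monomial one_ne_zero]
      exact_mod_cast hγ
    rw [supported_eq_range_rename] at this
    exact this
  have hfin : Module.Finite (MvPolynomial V K) (MvPolynomial (Fin n) K ⧸ I) := by
    refine ⟨⟨E.image fun e => Ideal.Quotient.mkₐ K I (monomial e 1), ?_⟩⟩
    rw [eq_top_iff]
    set N := Submodule.span (MvPolynomial V K)
      (E.image fun e => Ideal.Quotient.mkₐ K I (monomial e 1) : Set (MvPolynomial (Fin n) K ⧸ I))
      with hN
    have hsmul (c : K) (x : MvPolynomial (Fin n) K ⧸ I) (hx : x ∈ N) : c • x ∈ N := by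
      have : c • x = (C c : MvPolynomial V K) • x := by
        rw [Algebra.smul_def (C c : MvPolynomial V K)]
        refine (Algebra.smul_def c x).trans ?_
        congr 1
        exact (f.commutes c).symm
      rw [this]
      exact N.smul_mem _ hx
    have hstd (α : Fin n →₀ ℕ) : Ideal.Quotient.mkₐ K I (monomial α 1) ∈ N := by
      refine Submodule.span_induction ?_ N.zero_mem (fun x y _ _ => N.add_mem)
        (fun c x _ => hsmul c x) (mk_monomial_mem_span hI α)
      rintro _ ⟨β, ⟨hβ, -⟩, rfl⟩
      obtain ⟨e, he, γ, hγ, rfl⟩ := hV.exists_add β hβ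
      obtain ⟨p, hp⟩ := hmonomial γ hγ
      have : Ideal.Quotient.mkₐ K I (monomial (γ + e) 1) =
          p • Ideal.Quotient.mkₐ K I (monomial e 1) := by
        rw [Algebra.smul_def]
        change _ = Ideal.Quotient.mkₐ K I (rename (Subtype.val : V → Fin n) p) * _
        rw [hp, ← map_mul, monomial_mul, one_mul]
      simp only [this]
      exact N.smul_mem _ (Submodule.subset_span (Finset.mem_coe.2 (Finset.mem_image_of_mem _ he)))
    rintro x -
    obtain ⟨p, rfl⟩ := Ideal.Quotient.mkₐ_surjective K I x
    rw [p.as_sum, map_sum]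
    refine N.sum_mem fun α _ => ?_
    have : monomial α (coeff α p) = coeff α p • monomial α (1 : K) := by
      rw [smul_monomial, smul_eq_mul, mul_one]
    rw [this, map_smul]
    exact hsmul _ _ (hstd α)
  rw [← ringKrullDim_eq_of_isIntegral hinj, MvPolynomial.ringKrullDim_of_isNoetherianRing,
    ringKrullDim_eq_zero_of_field, zero_add, Nat.card_eq_fintype_card, Fintype.card_coe]

end IsStdNormalization

variable {H : Finset (MvPolynomial (Fin n) K)}

/-- Leading ideals with a Pommaret basis are quasi-stable. -/
theorem IsPommaretBasis.exists_single_mem (hH : IsPommaretBasis H I)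
    {α : Fin n →₀ ℕ} (hα : α ∈ ltSet I) {j : Fin n} (hj : ∀ i < j, α i = 0) :
    ∃ a, Finsupp.single j a ∈ ltSet I := by
  classical
  set N := (H.sup fun h => ltExp h j) + 1 with hN
  obtain ⟨h, hh, hle, hsub⟩ := hH.mem_ltSet_iff.1 (add_mem_ltSet (Finsupp.single j N) hα)
  have hlt : ltExp h j < N := Nat.lt_succ_of_le (Finset.le_sup (f := fun h => ltExp h j) hh)
  have hjm : j ∈ multVars (ltExp h) := by
    refine hsub ?_
    rw [Finsupp.mem_support_iff, Finsupp.tsub_apply, Finsupp.add_apply, Finsupp.single_eq_same]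
    omega
  have hcls : cls (ltExp h) ≤ j := (Finset.mem_filter.1 hjm).2
  refine ⟨ltExp h j, ?_⟩
  convert! hH.ltExp_mem_ltSet hh using 1
  ext i
  rcases lt_trichotomy i j with hij | rfl | hij
  · have := hle i
    rw [Finsupp.add_apply, hj i hij, Finsupp.single_eq_of_ne hij.ne] at this
    rw [Finsupp.single_eq_of_ne hij.ne]
    omega
  · simp
  · rw [Finsupp.single_eq_of_ne hij.ne']
    by_contra hne
    have h1 : (i : WithBot (Fin n)) ≤ cls (ltExp h) :=
      Finset.le_max (Finsupp.mem_support_iff.2 (Ne.symm hne))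
    exact absurd (WithBot.coe_le_coe.1 (h1.trans hcls)) (not_le.2 hij)

theorem IsPommaretBasis.exists_isStdNormalization (hH : IsPommaretBasis H I) (hI : I ≠ ⊤) :
    ∃ V E, IsStdNormalization I V E := by
  classical
  have hex : ∃ j, ∀ hj : j < n, ∀ a, Finsupp.single (⟨j, hj⟩ : Fin n) a ∉ ltSet I :=
    ⟨n, fun h => absurd h (lt_irrefl n)⟩
  set j := Nat.find hex with hj
  have hpow (i : Fin n) : ∃ a, i.1 < j → Finsupp.single i a ∈ ltSet I := by
    by_cases hi : i.1 < j
    · have := Nat.find_min hex hi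
      push Not at this
      obtain ⟨_, a, ha⟩ := this
      exact ⟨a, fun _ => ha⟩
    · exact ⟨0, fun h => absurd h hi⟩
  choose a ha using hpow
  refine ⟨Finset.univ.filter fun i => ¬ i.1 < j,
    Finset.Iic (Finsupp.equivFunOnFinite.symm a), fun α hα hsub => ?_, fun α hα => ?_⟩
  · have hzero (i : Fin n) (hi : i.1 < j) : α i = 0 := by
      by_contra hne
      exact (Finset.mem_filter.1 (hsub (Finsupp.mem_support_iff.2 hne))).2 hi
    by_cases hjn : j < n
    · obtain ⟨b, hb⟩ := hH.exists_single_mem hα (j := ⟨j, hjn⟩) fun i hi => hzero i hi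
      exact Nat.find_spec hex hjn b hb
    · refine zero_notMem_ltSet hI ?_
      convert! hα using 1
      ext i
      exact (hzero i (by omega)).symm
  · refine ⟨α.filter fun i => i.1 < j, ?_, α.filter fun i => ¬ i.1 < j, ?_, ?_⟩
    · rw [Finset.mem_Iic]
      intro i
      by_cases hi : i.1 < j
      · rw [Finsupp.filter_apply_pos (fun i : Fin n => i.1 < j) _ hi]
        by_contra hlt
        refine hα (mem_ltSet_of_le (ha i hi) ?_)
        rw [Finsupp.single_le_iff]
        exact (not_le.1 hlt).le
      · rw [Finsupp.filter_apply_neg (fun i : Fin n => i.1 < j) _ hi]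
        exact Nat.zero_le _
    · intro i hi
      rw [Finsupp.support_filter, Finset.mem_filter] at hi
      simpa using hi.2
    · rw [add_comm]
      exact Finsupp.filter_add_filter_not _ _

end Dimension
variable {K : Type*} [Field K] {n : ℕ} {I : Ideal (MvPolynomial (Fin n) K)}

theorem sum_mul_choose_succ_sub (c : ℕ → ℚ) (d S : ℕ) :
    ∑ m ∈ Finset.range (d + 2), c m * ((S + 1 + m).choose m : ℚ) -
      ∑ m ∈ Finset.range (d + 2), c m * ((S + m).choose m : ℚ) =
    ∑ i ∈ Finset.range (d + 1), c (i + 1) * ((S + 1 + i).choose i : ℚ) := by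
  rw [← Finset.sum_sub_distrib, Finset.sum_range_succ']
  simp only [Nat.choose_zero_right, sub_self, add_zero]
  refine Finset.sum_congr rfl fun i _ => ?_
  have : S + 1 + (i + 1) = S + 1 + i + 1 := rfl
  rw [this, Nat.choose_succ_succ, show S + (i + 1) = S + 1 + i by omega]
  push_cast
  ring

theorem hasDegree_of_stdCount (hI : I.IsHomogeneous (homogeneousSubmodule (Fin n) K)) {D : ℕ}
    (hD : ringKrullDim (MvPolynomial (Fin n) K ⧸ I) = (D : WithBot ℕ∞)) {c : ℕ → ℚ}
    (hc : c D ≠ 0)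
    (hG : ∀ᶠ S in atTop, (stdCount I S : ℚ) =
      ∑ m ∈ Finset.range (D + 1), c m * (S + m).choose m) :
    HasDegree I (c D) := by
  obtain ⟨N, hN⟩ := eventually_atTop.1 hG
  have hsucc (S : ℕ) : (hilbertFunction I (S + 1) : ℚ) = stdCount I (S + 1) - stdCount I S := by
    rw [stdCount_eq_sum hI, stdCount_eq_sum hI, Finset.sum_range_succ _ (S + 1)]
    push_cast
    ring
  cases D with
  | zero =>
    have hconst (S : ℕ) (hS : N ≤ S) : (stdCount I S : ℚ) = c 0 := by simp [hN S hS]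
    have hsupp : Function.support (hilbertFunction I) ⊆ Finset.range (N + 1) := by
      intro s hs
      rw [Finset.mem_coe, Finset.mem_range]
      by_contra hlt
      obtain ⟨t, rfl⟩ : ∃ t, s = t + 1 := ⟨s - 1, by omega⟩
      refine hs ?_
      have := hsucc t
      rw [hconst _ (by omega), hconst _ (by omega), sub_self] at this
      exact_mod_cast this
    refine Or.inr ⟨by simpa using hD, (Finset.finite_toSet _).subset hsupp, ?_⟩
    rw [finsum_eq_sum_of_support_subset _ hsupp, ← stdCount_eq_sum hI, hconst N le_rfl]
  | succ d =>
    refine Or.inl ⟨d, hD, binomialSum (fun i => c (i + 1)) (d + 1), ?_, ?_⟩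
    · refine eventually_atTop.2 ⟨N + 1, fun s hs => ?_⟩
      obtain ⟨t, rfl⟩ : ∃ t, s = t + 1 := ⟨s - 1, by omega⟩
      rw [hsucc, hN _ (by omega), hN _ (by omega), sum_mul_choose_succ_sub, eval_binomialSum]
    · rw [leadingCoeff_binomialSum_succ (c := fun i => c (i + 1)) hc]
      have : (d.factorial : ℚ) ≠ 0 := by exact_mod_cast d.factorial_ne_zero
      field_simp

theorem degreeCoeff_eq_sum {H : Finset (MvPolynomial (Fin n) K)} {D : ℕ} (hD : D ≠ n) :
    degreeCoeff H D = ∑ h ∈ H with D ≤ (polyMultVars h).card ∧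
        (polyMultVars h).card ≤ D + h.totalDegree,
      (-1 : ℚ) ^ ((polyMultVars h).card - D + 1) *
        (h.totalDegree.choose ((polyMultVars h).card - D) : ℚ) := by
  rw [degreeCoeff, if_neg hD, zero_sub, ← Finset.sum_neg_distrib, ← Finset.filter_filter,
    Finset.sum_filter (fun h : MvPolynomial (Fin n) K => _ ≤ D + h.totalDegree)]
  refine Finset.sum_congr rfl fun h _ => ?_
  split_ifs with hle
  · rw [pow_succ]
    ring
  · rw [Nat.choose_eq_zero_of_lt (by omega)]
    simp

end Pommaret

theorem mainTheorem2 {K : Type*} [Field K] {n : ℕ}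
    (I : Ideal (MvPolynomial (Fin n) K))
    (hI : I.IsHomogeneous (MvPolynomial.homogeneousSubmodule (Fin n) K))
    (hI0 : I ≠ ⊥)
    (D : ℕ) (hD : ringKrullDim (MvPolynomial (Fin n) K ⧸ I) = (D : WithBot ℕ∞))
    (H : Finset (MvPolynomial (Fin n) K)) (hH : Pommaret.IsPommaretBasis H I) :
    Pommaret.HasDegree I
      (∑ h ∈ H with D ≤ (Pommaret.polyMultVars h).card ∧
          (Pommaret.polyMultVars h).card ≤ D + h.totalDegree,
        (-1 : ℚ) ^ ((Pommaret.polyMultVars h).card - D + 1) *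
          (h.totalDegree.choose ((Pommaret.polyMultVars h).card - D) : ℚ)) := by
  have hI1 : I ≠ ⊤ := by
    rintro rfl
    rw [ringKrullDim_eq_bot_of_subsingleton] at hD
    exact WithBot.bot_ne_coe hD
  obtain ⟨V, E, hV⟩ := hH.exists_isStdNormalization hI1
  obtain rfl : V.card = D := by
    have := (hV.ringKrullDim_eq hI).symm.trans hD
    exact_mod_cast this
  have hDn : V.card ≠ n := by
    intro h
    obtain ⟨f, hf, hf0⟩ := Submodule.exists_mem_ne_zero_of_ne_bot hI0
    have hVu : V = Finset.univ := (Finset.card_eq_iff_eq_univ V).1 (by simpa using h)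
    exact hV.not_subset _ ⟨f, hf, hf0, rfl⟩ (hVu ▸ Finset.subset_univ _)
  rw [← Pommaret.degreeCoeff_eq_sum hDn]
  have hG : ∀ᶠ S in atTop, (Pommaret.stdCount I S : ℚ) =
      ∑ m ∈ Finset.range (n + 1), Pommaret.degreeCoeff H m * (S + m).choose m :=
    eventually_atTop.2 ⟨H.sup totalDegree, fun S hS =>
      hH.stdCount_eq fun h hh => (Finset.le_sup hh).trans hS⟩
  obtain ⟨hzero, hne, hle⟩ := Pommaret.coeff_of_growth hG hV.choose_le_stdCount (M := E.card)
    fun S => by exact_mod_cast hV.stdCount_le S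
  refine Pommaret.hasDegree_of_stdCount hI hD hne ?_
  filter_upwards [hG] with S hS
  rw [hS]
  refine (Finset.sum_subset (Finset.range_subset_range.2 (by omega)) fun m hm hm' => ?_).symm
  rw [Finset.mem_range] at hm hm'
  rw [hzero m (by omega) (by omega), zero_mul]
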